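/- Let $G$ be a finite graph (multiple edges and loops allowed), fix a reference orientation of $G$, and let $\mathcal F(G)\subset\mathbb Z^{E(G)}$ be its lattice of integer flows (the integer edge labellings for which, at every vertex, the sum over the incoming edges equals the sum over the outgoing edges), with the inner product induced by the Euclidean inner product of $\mathbb R^{E(G)}$. Let $\mathrm{Vor}(G)$ be the Voronoi cell of $\mathcal F(G)$, i.e. the polytope of all points of $\mathcal F(G)\otimes\mathbb R$ that are at least as close to the origin as to any other lattice point. Faces are non-empty and include $\mathrm{Vor}(G)$ itself. A subgraph of $G$ means a spanning subgraph. An orientation of a subgraph $H$ is the choice of one of the two directions for each edge of $H$ (a loop also has two directions); it is strong if for any two vertices $u,v$ in the same connected component of $H$ there are directed paths from $u$ to $v$ and from $v$ to $u$. An oriented circuit $C$ of $G$ is a closed walk of positive length that repeats no vertex and no edge; write $C$ also for the flow whose coefficient at an edge is $\pm1$ if $C$ traverses it along, respectively against, the reference orientation, and $0$ if the edge is not in $C$. Put $F_C=\{x\in\mathrm{Vor}(G):(x,C)=\tfrac12(C,C)\}$. For a strong orientation $\omega_H$ of a subgraph $H$, let $F_{H,\omega_H}$ be the corresponding face of $\mathrm{Vor}(G)$: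 the intersection, within $\mathrm{Vor}(G)$, of the sets $F_C$ over all oriented circuits $C$ contained in $H$ that are directed according to $\omega_H$ (so $F_{H,\omega_H}=\mathrm{Vor}(G)$ if $H$ has no edges). **Proposition.** Let $H$ be a strongly orientable subgraph of $G$ and let $\omega_H$ be a strong orientation of $H$. Then $$\{F_{H,\omega'_H} : \omega'_H \text{ a strong orientation of } H\}$$ is exactly the set of the faces $F$ of $\mathrm{Vor}(G)$ that are parallel to $F_{H,\omega_H}$ (that is, their affine spans are parallel) and have the same codimension in $\mathcal F(G)\otimes\mathbb R$ as $F_{H,\omega_H}$. -/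

import Mathlib

open scoped Graph

noncomputable section

namespace Graph

variable {α β : Type*}

/-- A reference orientation of a multigraph (loops and multiple edges allowed): every edge gets a
source and a target among its ends. Integer flows are written in terms of it. -/
structure RefOrientation (G : Graph α β) where
  src : E(G) → α
  tgt : E(G) → α
  isLink : ∀ e : E(G), G.IsLink e (src e) (tgt e)

variable {G : Graph α β}

/-- A direction of an edge is a sign `s : ℤˣ`: `1` is the reference direction, `-1` the reverse.
(Thus a loop has two directions as well.) This is the tail of `e` in the direction `s`. -/
def RefOrientation.tail (o : G.RefOrientation) (s : ℤˣ) (e : E(G)) : α :=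
  if s = 1 then o.src e else o.tgt e

/-- The head of `e` in the direction `s`. -/
def RefOrientation.head (o : G.RefOrientation) (s : ℤˣ) (e : E(G)) : α :=
  if s = 1 then o.tgt e else o.src e

/-- An orientation of a subgraph `H` of `G` is a choice of direction for each edge of `H`. -/
abbrev SubOrientation (H : Graph α β) : Type _ := E(H) → ℤˣ

/-- `x` is the tail and `y` is the head of some edge of `H`, oriented by `ω`. -/
def RefOrientation.DirAdj (o : G.RefOrientation) {H : Graph α β} (hH : H ≤s G)
    (ω : SubOrientation H) (x y : α) : Prop :=
  ∃ e : E(H), o.tail (ω e) ⟨e, hH.le.edgeSet_mono e.2⟩ = x ∧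
    o.head (ω e) ⟨e, hH.le.edgeSet_mono e.2⟩ = y

/-- `ω` is a strong orientation of the (not necessarily connected) spanning subgraph `H`: for any
two vertices `u`, `v` in the same connected component of `H` there is a directed path from `u`
to `v` (and, exchanging `u` and `v`, one from `v` to `u`). -/
def RefOrientation.IsStrong (o : G.RefOrientation) {H : Graph α β} (hH : H ≤s G)
    (ω : SubOrientation H) : Prop :=
  ∀ u ∈ V(H), ∀ v ∈ V(H), Relation.ReflTransGen H.Adj u v →
    Relation.ReflTransGen (o.DirAdj hH ω) u v

/-- An oriented circuit of `G`: a closed walk, with `n + 1 ≥ 1` edges, that repeats no vertex and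
no edge. The `i`-th edge, traversed in the direction `sign i`, goes from the `i`-th vertex to the
next one; indices are cyclic (`i + 1` is addition modulo `n + 1` in `Fin (n + 1)`). -/
structure RefOrientation.OrientedCircuit (o : G.RefOrientation) where
  n : ℕ
  vert : Fin (n + 1) → α
  edge : Fin (n + 1) → E(G)
  sign : Fin (n + 1) → ℤˣ
  vert_injective : Function.Injective vert
  edge_injective : Function.Injective edge
  tail_eq : ∀ i, o.tail (sign i) (edge i) = vert i
  head_eq : ∀ i, o.head (sign i) (edge i) = vert (i + 1)

open Classical in
/-- The circuit element: the coefficient of `e` is `1` or `-1` if the circuit traverses `e` in the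
reference direction or against it, and `0` if `e` is not in the circuit. -/
def RefOrientation.OrientedCircuit.elem {o : G.RefOrientation} (C : o.OrientedCircuit) :
    E(G) → ℤ :=
  fun e => ∑ i, if C.edge i = e then ((C.sign i : ℤˣ) : ℤ) else 0

/-- The oriented circuit `C` lies in the subgraph `H` and follows the orientation `ω` of `H`. -/
def RefOrientation.OrientedCircuit.Follows {o : G.RefOrientation} (C : o.OrientedCircuit)
    {H : Graph α β} (ω : SubOrientation H) : Prop :=
  ∀ i, ∃ h : (C.edge i : β) ∈ E(H), ω ⟨C.edge i, h⟩ = C.sign i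

section Voronoi

variable [Fintype E(G)]

open Classical in
/-- The group of integer flows: integer edge labellings such that at each vertex the sum over
incoming edges equals the sum over outgoing edges. -/
def RefOrientation.intFlows (o : G.RefOrientation) : AddSubgroup (E(G) → ℤ) where
  carrier := {a | ∀ v : α, (∑ e, if o.tgt e = v then a e else 0) =
    ∑ e, if o.src e = v then a e else 0}
  zero_mem' := by intro v; simp
  add_mem' := by
    intro a b ha hb v
    have h : ∀ f : E(G) → α, (∑ e, if f e = v then (a + b) e else 0) =
        (∑ e, if f e = v then a e else 0) + ∑ e, if f e = v then b e else 0 := by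
      intro f
      rw [← Finset.sum_add_distrib]
      refine Finset.sum_congr rfl fun e _ => ?_
      split_ifs <;> simp
    rw [h, h, ha v, hb v]
  neg_mem' := by
    intro a ha v
    have h : ∀ f : E(G) → α, (∑ e, if f e = v then (-a) e else 0) =
        -∑ e, if f e = v then a e else 0 := by
      intro f
      rw [← Finset.sum_neg_distrib]
      refine Finset.sum_congr rfl fun e _ => ?_
      split_ifs <;> simp
    rw [h, h, ha v]

/-- The inclusion of `ℤ^E` in the Euclidean space `ℝ^E`. -/
def toEuclidean (a : E(G) → ℤ) : EuclideanSpace ℝ E(G) :=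
  WithLp.toLp 2 fun e => (a e : ℝ)

/-- The Euclidean space spanned by the lattice of integer flows (its tensor product with `ℝ`). -/
def RefOrientation.flowSpace (o : G.RefOrientation) : Submodule ℝ (EuclideanSpace ℝ E(G)) :=
  Submodule.span ℝ (toEuclidean '' (o.intFlows : Set (E(G) → ℤ)))

/-- The Voronoi cell of the lattice of integer flows: the points of the flow space at least as
close to the origin as to any other lattice point. -/
def RefOrientation.voronoiCell (o : G.RefOrientation) : Set o.flowSpace :=
  {x | ∀ a ∈ o.intFlows,
    dist (x : EuclideanSpace ℝ E(G)) 0 ≤ dist (x : EuclideanSpace ℝ E(G)) (toEuclidean a)}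

/-- The faces of the Voronoi cell, a polytope: its nonempty exposed subsets, including the cell
itself. -/
def RefOrientation.IsVoronoiFace (o : G.RefOrientation) (F : Set o.flowSpace) : Prop :=
  F.Nonempty ∧ IsExposed ℝ o.voronoiCell F

/-- The codimension, in the flow space, of the affine span of `F`. -/
def RefOrientation.codim (o : G.RefOrientation) (F : Set o.flowSpace) : ℕ :=
  Module.finrank ℝ o.flowSpace - Module.finrank ℝ (vectorSpan ℝ F)

/-- The part of the Voronoi cell on the perpendicular bisector `(x, C) = (C, C) / 2` of the circuit
element `C`. -/
def RefOrientation.circuitFacet (o : G.RefOrientation) (C : o.OrientedCircuit) :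
    Set o.flowSpace :=
  {x | x ∈ o.voronoiCell ∧ inner ℝ (x : EuclideanSpace ℝ E(G)) (toEuclidean C.elem) =
    inner ℝ (toEuclidean C.elem) (toEuclidean C.elem) / 2}

/-- The face of the Voronoi cell corresponding to the pair `(H, ω)`: the intersection, within the
cell, of the codimension one faces of all oriented circuits contained in `(H, ω)`. For `H` without
edges it is the whole cell. -/
def RefOrientation.voronoiFace (o : G.RefOrientation) {H : Graph α β}
    (ω : SubOrientation H) : Set o.flowSpace :=
  {x | x ∈ o.voronoiCell ∧ ∀ C : o.OrientedCircuit, C.Follows ω → x ∈ o.circuitFacet C}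

end Voronoi

end Graph

end

/-! The Voronoi cell is the orthogonal projection of the cube `[-1/2, 1/2]^E` to the flow space:
every flow is a conformal (cancellation-free) sum of multiples of circuits, so in direction `f` both
bodies are bounded by half the l¹ norm of `f`. Hence the face exposed by a flow `f` is the
projection of a cube face, with the coordinates in the support of `f` fixed by its signs
(`setOf_isMax_inner_eq_cubeFace`).

The normal space of such a face consists of the flows supported on the fixed coordinates
(`mem_orthogonal_vectorSpan_cubeFace`), whatever the signs. An orientation of `H` is strong exactly
when some flow has support `E(H)` and these signs, so all faces of strong orientations of `H` are
parallel. Conversely, if a parallel face is exposed by `g`, comparing normal spaces shows that `g`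
has support `E(H)`, and the signs of `g` are the required strong orientation. -/

theorem Relation.ReflTransGen.exists_injOn_path {α : Type*} {r : α → α → Prop} {a b : α}
    (h : Relation.ReflTransGen r a b) :
    ∃ (n : ℕ) (p : ℕ → α), p 0 = a ∧ p n = b ∧ (∀ i < n, r (p i) (p (i + 1))) ∧
      Set.InjOn p (Set.Iic n) := by
  induction h with
  | refl => exact ⟨0, fun _ => a, rfl, rfl, by simp, by intro i hi j hj _; simp_all⟩
  | @tail c d _ hcd ih =>
    obtain ⟨n, p, h0, hn, hr, hinj⟩ := ih
    by_cases hd : ∃ k ≤ n, p k = d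
    · obtain ⟨k, hk, rfl⟩ := hd
      exact ⟨k, p, h0, rfl, fun i hi => hr i (hi.trans_le hk),
        hinj.mono (Set.Iic_subset_Iic.2 hk)⟩
    · push Not at hd
      refine ⟨n + 1, fun i => if i ≤ n then p i else d, by simpa using h0, by simp, ?_, ?_⟩
      · intro i hi
        rcases Nat.lt_succ_iff_lt_or_eq.1 hi with hi | rfl
        · simpa [hi.le, Nat.succ_le_of_lt hi] using hr i hi
        · simpa [hn] using hcd
      · intro i hi j hj hij
        simp only [Set.mem_Iic] at hi hj
        dsimp only at hij
        split_ifs at hij with h1 h2 h2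
        · exact hinj h1 h2 hij
        · exact absurd hij (hd i h1)
        · exact absurd hij.symm (hd j h2)
        · omega

/-! ### Circuits and directed reachability. -/

namespace Graph.RefOrientation

variable {α β : Type*} {G : Graph α β}

/-- `x` is the tail and `y` is the head of some edge in `S`, directed by `σ`. -/
def Arc (o : G.RefOrientation) (S : Set E(G)) (σ : E(G) → ℤˣ) (x y : α) : Prop :=
  ∃ e ∈ S, o.tail (σ e) e = x ∧ o.head (σ e) e = y

/-- A vertex-injective path from the head of `e` to its tail is closed up by `e`. Distinct vertices
force distinct edges, since `σ` gives each edge a single tail. -/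
theorem exists_orientedCircuit (o : G.RefOrientation) {S : Set E(G)} {σ : E(G) → ℤˣ} {e : E(G)}
    (he : e ∈ S)
    (h : Relation.ReflTransGen (o.Arc S σ) (o.head (σ e) e) (o.tail (σ e) e)) :
    ∃ C : o.OrientedCircuit, (∀ i, C.edge i ∈ S ∧ σ (C.edge i) = C.sign i) ∧
      ∃ i, C.edge i = e := by
  obtain ⟨n, p, h0, hn, hr, hinj⟩ := h.exists_injOn_path
  have : Nonempty E(G) := ⟨e⟩
  choose! f hfS hft hfh using hr
  -- The last index `n` is the closing edge `e`; its cyclic successor is `0`.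
  let edge : Fin (n + 1) → E(G) := fun i => if (i : ℕ) < n then f i else e
  have hS : ∀ i, edge i ∈ S := by
    intro i
    by_cases hi : (i : ℕ) < n
    · simpa [edge, hi] using hfS i hi
    · simpa [edge, hi] using he
  have ht : ∀ i, o.tail (σ (edge i)) (edge i) = p i := by
    intro i
    by_cases hi : (i : ℕ) < n
    · simpa [edge, hi] using hft i hi
    · have : (i : ℕ) = n := by omega
      simp [edge, this, hn]
  have hh : ∀ i, o.head (σ (edge i)) (edge i) = p (i + 1 : Fin (n + 1)) := by
    intro i
    rw [Fin.val_add_one]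
    by_cases hi : (i : ℕ) < n
    · have : i ≠ Fin.last n := by rintro rfl; simp at hi
      simpa [edge, hi, this] using hfh i hi
    · have : i = Fin.last n := Fin.ext (by simp; omega)
      simp [edge, this, h0]
  have hpi : Function.Injective fun i : Fin (n + 1) => p i := fun i j hij =>
    Fin.ext (hinj (Nat.lt_succ_iff.1 i.2) (Nat.lt_succ_iff.1 j.2) hij)
  refine ⟨⟨n, fun i => p i, edge, fun i => σ (edge i), hpi, ?_, ht, hh⟩, fun i => ⟨hS i, rfl⟩,
    Fin.last n, by simp [edge]⟩
  intro i j hij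
  refine hpi ?_
  change p i = p j
  rw [← ht, ← ht, hij]

theorem OrientedCircuit.elem_edge {o : G.RefOrientation} (C : o.OrientedCircuit)
    (i : Fin (C.n + 1)) : C.elem (C.edge i) = C.sign i := by
  classical
  rw [OrientedCircuit.elem, Finset.sum_eq_single i]
  · simp
  · intro j _ hj
    rw [if_neg fun h => hj (C.edge_injective h)]
  · simp

theorem OrientedCircuit.elem_of_forall_ne {o : G.RefOrientation} (C : o.OrientedCircuit)
    {e : E(G)} (h : ∀ i, C.edge i ≠ e) : C.elem e = 0 := by
  classical
  exact Finset.sum_eq_zero fun i _ => if_neg (h i)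

theorem OrientedCircuit.elem_eq {o : G.RefOrientation} (C : o.OrientedCircuit)
    {S : Set E(G)} {σ : E(G) → ℤˣ} (hC : ∀ i, C.edge i ∈ S ∧ σ (C.edge i) = C.sign i) (e : E(G)) :
    C.elem e = 0 ∨ (e ∈ S ∧ C.elem e = σ e) := by
  by_cases h : ∃ i, C.edge i = e
  · obtain ⟨i, rfl⟩ := h
    exact Or.inr ⟨(hC i).1, by rw [C.elem_edge, (hC i).2]⟩
  · push Not at h
    exact Or.inl (C.elem_of_forall_ne h)

theorem OrientedCircuit.elem_mul_self {o : G.RefOrientation} (C : o.OrientedCircuit) (e : E(G)) :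
    C.elem e * C.elem e = |C.elem e| := by
  by_cases h : ∃ i, C.edge i = e
  · obtain ⟨i, rfl⟩ := h
    rw [C.elem_edge]
    rcases Int.units_eq_one_or (C.sign i) with h | h <;> simp [h]
  · push Not at h
    simp [C.elem_of_forall_ne h]

@[simp] theorem _root_.Graph.toEuclidean_apply (a : E(G) → ℤ) (e : E(G)) :
    toEuclidean a e = (a e : ℝ) := rfl

variable [Fintype E(G)]

theorem OrientedCircuit.elem_mem_intFlows {o : G.RefOrientation} (C : o.OrientedCircuit) :
    C.elem ∈ o.intFlows := by
  classical
  have key : ∀ (g : E(G) → α) (v : α), (∑ e, if g e = v then C.elem e else 0) =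
      ∑ i, if g (C.edge i) = v then ((C.sign i : ℤˣ) : ℤ) else 0 := by
    intro g v
    simp only [OrientedCircuit.elem, ← Finset.sum_filter]
    rw [Finset.sum_comm' (t' := Finset.univ.filter fun i => g (C.edge i) = v)
      (s' := fun i => {C.edge i})]
    · refine Finset.sum_congr rfl fun i _ => by simp
    · intro e i
      simp only [Finset.mem_filter, Finset.mem_univ, true_and, Finset.mem_singleton]
      constructor
      · rintro ⟨h, rfl⟩; exact ⟨rfl, h⟩
      · rintro ⟨rfl, h⟩; exact ⟨h, rfl⟩
  intro v
  -- The cyclic shift is a bijection, so `v` is entered as often as it is left.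
  have hv : (∑ i, if C.vert (i + 1) = v then (1 : ℤ) else 0) =
      ∑ i, if C.vert i = v then (1 : ℤ) else 0 :=
    Equiv.sum_comp (Equiv.addRight (1 : Fin (C.n + 1))) fun i => if C.vert i = v then (1 : ℤ) else 0
  rw [← sub_eq_zero, key, key, ← Finset.sum_sub_distrib]
  rw [← sub_eq_zero, ← Finset.sum_sub_distrib] at hv
  refine (Finset.sum_congr rfl fun i _ => ?_).trans hv
  rw [← C.tail_eq i, ← C.head_eq i, RefOrientation.tail, RefOrientation.head]
  rcases Int.units_eq_one_or (C.sign i) with h | h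
  · simp [h]
  · simp only [h, if_neg (by decide : ¬ (-1 : ℤˣ) = 1)]
    split_ifs <;> simp

theorem toEuclidean_mem_flowSpace (o : G.RefOrientation) {a : E(G) → ℤ} (ha : a ∈ o.intFlows) :
    toEuclidean a ∈ o.flowSpace :=
  Submodule.subset_span ⟨a, ha, rfl⟩

/-- Summation by parts: flows are orthogonal to potential differences. -/
theorem sum_mul_potential_eq_zero (o : G.RefOrientation) {f : EuclideanSpace ℝ E(G)}
    (hf : f ∈ o.flowSpace) (φ : α → ℝ) : ∑ e, f e * (φ (o.tgt e) - φ (o.src e)) = 0 := by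
  classical
  induction hf using Submodule.span_induction with
  | zero => simp
  | add x y _ _ hx hy =>
    simp only [PiLp.add_apply, add_mul, Finset.sum_add_distrib, hx, hy, add_zero]
  | smul c x _ hx =>
    simp only [PiLp.smul_apply, smul_eq_mul, mul_assoc, ← Finset.mul_sum, hx, mul_zero]
  | mem x hx =>
    obtain ⟨a, ha, rfl⟩ := hx
    let W : Finset α := Finset.univ.image o.src ∪ Finset.univ.image o.tgt
    have key : ∀ g : E(G) → α, (∀ e, g e ∈ W) →
        ∑ e, (a e : ℝ) * φ (g e) = ∑ v ∈ W, φ v * ((∑ e, if g e = v then a e else 0 : ℤ) : ℝ) := by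
      intro g hg
      push_cast
      simp_rw [Finset.mul_sum]
      rw [Finset.sum_comm]
      refine Finset.sum_congr rfl fun e _ => ?_
      rw [Finset.sum_eq_single_of_mem (g e) (hg e)]
      · simp [mul_comm]
      · intro v _ hv
        simp [hv.symm]
    simp only [toEuclidean_apply, mul_sub, Finset.sum_sub_distrib]
    rw [key o.tgt (by simp [W]), key o.src (by simp [W]), sub_eq_zero]
    refine Finset.sum_congr rfl fun v _ => ?_
    congr 2
    have := ha v
    convert this

/-- The arcs supporting a positive flow can be traversed backwards by directed paths. -/
theorem reflTransGen_arc_symm (o : G.RefOrientation) {f : EuclideanSpace ℝ E(G)}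
    (hf : f ∈ o.flowSpace) {S : Set E(G)} {σ : E(G) → ℤˣ}
    (hpos : ∀ e ∈ S, 0 < ((σ e : ℤ) : ℝ) * f e) (hzero : ∀ e ∉ S, f e = 0) {x y : α}
    (h : o.Arc S σ x y) : Relation.ReflTransGen (o.Arc S σ) y x := by
  classical
  obtain ⟨e, he, rfl, rfl⟩ := h
  set y := o.head (σ e) e
  -- No arc leaves the set reachable from `y`, so every term of the potential sum is nonnegative.
  -- The sum is zero, so no arc enters the set either; in particular the tail of `e` lies in it.
  let φ : α → ℝ := fun z => if Relation.ReflTransGen (o.Arc S σ) y z then 1 else 0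
  have hterm : ∀ e, f e * (φ (o.tgt e) - φ (o.src e)) =
      ((σ e : ℤ) : ℝ) * f e * (φ (o.head (σ e) e) - φ (o.tail (σ e) e)) := by
    intro e
    rw [RefOrientation.tail, RefOrientation.head]
    rcases Int.units_eq_one_or (σ e) with h | h
    · simp [h]
    · simp only [h, if_neg (by decide : ¬ (-1 : ℤˣ) = 1)]
      push_cast
      ring
  have hsum := o.sum_mul_potential_eq_zero hf φ
  have hnonneg : ∀ e ∈ Finset.univ, 0 ≤ f e * (φ (o.tgt e) - φ (o.src e)) := by
    intro e _
    by_cases he : e ∈ S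
    · rw [hterm]
      refine mul_nonneg (hpos e he).le ?_
      by_cases ht : Relation.ReflTransGen (o.Arc S σ) y (o.tail (σ e) e)
      · have hh : Relation.ReflTransGen (o.Arc S σ) y (o.head (σ e) e) := ht.tail ⟨e, he, rfl, rfl⟩
        simp [φ, ht, hh]
      · simp only [φ, if_neg ht, sub_zero]
        split_ifs <;> norm_num
    · simp [hzero e he]
  have := (Finset.sum_eq_zero_iff_of_nonneg hnonneg).1 hsum e (Finset.mem_univ e)
  rw [hterm, mul_eq_zero, or_iff_right (hpos e he).ne', sub_eq_zero] at this
  by_contra hcon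
  have hy : Relation.ReflTransGen (o.Arc S σ) y (o.head (σ e) e) := .refl
  simp [φ, hcon, hy] at this

end Graph.RefOrientation

theorem Int.units_coe_real_eq_one_or (u : ℤˣ) : ((u : ℤ) : ℝ) = 1 ∨ ((u : ℤ) : ℝ) = -1 := by
  rcases Int.units_eq_one_or u with h | h <;> simp [h]

theorem EuclideanSpace.real_inner_eq_sum {ι : Type*} [Fintype ι] (x y : EuclideanSpace ℝ ι) :
    inner ℝ x y = ∑ i, x i * y i := by
  simp [PiLp.inner_apply, mul_comm]

/-- The direction of each edge in which `f` is nonnegative. -/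
noncomputable def Graph.flowDirection {α β : Type*} {G : Graph α β} (f : EuclideanSpace ℝ E(G)) (e : E(G)) : ℤˣ :=
  open Classical in if 0 ≤ f e then 1 else -1

theorem Graph.flowDirection_mul {α β : Type*} {G : Graph α β} (f : EuclideanSpace ℝ E(G))
    (e : E(G)) : ((flowDirection f e : ℤ) : ℝ) * f e = |f e| := by
  unfold flowDirection
  split_ifs with h
  · simp [abs_of_nonneg h]
  · simp [abs_of_neg (not_le.1 h)]

/-! ### The Voronoi cell as a projected cube. -/

namespace Graph.RefOrientation

variable {α β : Type*} {G : Graph α β} [Fintype E(G)]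

theorem mem_voronoiCell_iff (o : G.RefOrientation) (x : o.flowSpace) :
    x ∈ o.voronoiCell ↔ ∀ a ∈ o.intFlows,
      inner ℝ (x : EuclideanSpace ℝ E(G)) (toEuclidean a) ≤
        inner ℝ (toEuclidean a) (toEuclidean a) / 2 := by
  refine forall₂_congr fun a _ => ?_
  rw [dist_zero_right, dist_eq_norm, ← sq_le_sq₀ (norm_nonneg _) (norm_nonneg _),
    norm_sub_sq_real, real_inner_self_eq_norm_sq]
  constructor <;> intro h <;> linarith

theorem OrientedCircuit.inner_elem_self {o : G.RefOrientation} (C : o.OrientedCircuit) :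
    inner ℝ (toEuclidean C.elem) (toEuclidean C.elem) = ∑ e, |(C.elem e : ℝ)| := by
  rw [EuclideanSpace.real_inner_eq_sum]
  refine Finset.sum_congr rfl fun e _ => ?_
  simp only [toEuclidean_apply]
  exact_mod_cast C.elem_mul_self e

theorem exists_orientedCircuit_of_ne_zero (o : G.RefOrientation) {f : EuclideanSpace ℝ E(G)}
    (hf : f ∈ o.flowSpace) (hf0 : f ≠ 0) :
    ∃ C : o.OrientedCircuit, ∀ i, f (C.edge i) ≠ 0 ∧
      flowDirection f (C.edge i) = C.sign i := by
  have : ∃ e, f e ≠ 0 := by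
    by_contra! h
    exact hf0 (PiLp.ext h)
  obtain ⟨e, he⟩ := this
  obtain ⟨C, hC, -⟩ := o.exists_orientedCircuit (S := {e | f e ≠ 0}) (σ := flowDirection f) he
    (o.reflTransGen_arc_symm hf (fun e he => by rw [flowDirection_mul]; exact abs_pos.2 he)
      (fun e he => by simpa using he) ⟨e, he, rfl, rfl⟩)
  exact ⟨C, hC⟩

/-- For a circuit, the l¹ norm equals `(C, C)`, so this is the Voronoi inequality. In general, peel
off circuits that agree in sign with `f`: the l¹ norm is additive along the way. -/
theorem inner_le_of_mem_voronoiCell (o : G.RefOrientation) {x : o.flowSpace}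
    (hx : x ∈ o.voronoiCell) {f : EuclideanSpace ℝ E(G)} (hf : f ∈ o.flowSpace) :
    inner ℝ (x : EuclideanSpace ℝ E(G)) f ≤ (∑ e, |f e|) / 2 := by
  classical
  induction hn : (Finset.univ.filter fun e => f e ≠ 0).card using Nat.strong_induction_on
    generalizing f with
  | _ n ih =>
  by_cases hf0 : f = 0
  · simp [hf0]
  obtain ⟨C, hC⟩ := o.exists_orientedCircuit_of_ne_zero hf hf0
  obtain ⟨i₀, -, hi₀⟩ := Finset.exists_min_image Finset.univ (fun i => |f (C.edge i)|)
    ⟨0, Finset.mem_univ _⟩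
  -- The smallest absolute value on the circuit: subtracting `t • C` flips no sign and kills the
  -- edge `i₀`.
  set t := |f (C.edge i₀)|
  have ht : 0 < t := abs_pos.2 (hC i₀).1
  set f' : EuclideanSpace ℝ E(G) := f - t • toEuclidean C.elem
  have hf' : f' ∈ o.flowSpace :=
    o.flowSpace.sub_mem hf (o.flowSpace.smul_mem _ (o.toEuclidean_mem_flowSpace C.elem_mem_intFlows))
  have hf'e : ∀ e, f' e = f e - t * C.elem e := fun e => by simp [f']
  have hedge : ∀ i, f' (C.edge i) = (|f (C.edge i)| - t) * ((C.sign i : ℤ) : ℝ) := by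
    intro i
    rw [hf'e, C.elem_edge, ← flowDirection_mul, (hC i).2]
    rcases Int.units_coe_real_eq_one_or (C.sign i) with h | h <;> simp [h]; ring
  have habs : ∀ e, |f' e| = |f e| - t * |(C.elem e : ℝ)| := by
    intro e
    by_cases h : ∃ i, C.edge i = e
    · obtain ⟨i, rfl⟩ := h
      rw [hedge, C.elem_edge, abs_mul, abs_of_nonneg (sub_nonneg.2 (hi₀ i (Finset.mem_univ i)))]
      rcases Int.units_coe_real_eq_one_or (C.sign i) with h | h <;> simp [h]
    · push Not at h
      simp [hf'e, C.elem_of_forall_ne h]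
  have hlt : (Finset.univ.filter fun e => f' e ≠ 0).card < n := by
    rw [← hn]
    refine Finset.card_lt_card (Finset.ssubset_iff_of_subset ?_ |>.2 ⟨C.edge i₀, ?_, ?_⟩)
    · intro e
      simp only [Finset.mem_filter, Finset.mem_univ, true_and]
      intro h1 h2
      have h3 := habs e
      rw [h2, abs_zero] at h3
      have := abs_pos.2 h1
      have := mul_nonneg ht.le (abs_nonneg (C.elem e : ℝ))
      linarith
    · simpa using (hC i₀).1
    · simp [hedge, t]
  have hCx := (o.mem_voronoiCell_iff x).1 hx _ C.elem_mem_intFlows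
  have hrec := ih _ hlt hf' rfl
  simp only [habs, Finset.sum_sub_distrib, ← Finset.mul_sum] at hrec
  rw [C.inner_elem_self] at hCx
  have hsum : inner ℝ (x : EuclideanSpace ℝ E(G)) f =
      inner ℝ (x : EuclideanSpace ℝ E(G)) f' +
        t * inner ℝ (x : EuclideanSpace ℝ E(G)) (toEuclidean C.elem) := by
    rw [← real_inner_smul_right, ← inner_add_right]
    simp [f']
  rw [hsum]
  nlinarith [mul_le_mul_of_nonneg_left hCx ht.le]

/-- The image in the flow space of the face of the cube `[-1/2, 1/2]^E` on which the coordinates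
in `S` are the vertices of `[-1/2, 1/2]` given by the signs `σ`. -/
def cubeFace (o : G.RefOrientation) (S : Set E(G)) (σ : E(G) → ℤˣ) : Set o.flowSpace :=
  o.flowSpace.orthogonalProjectionOnto ''
    {y | (∀ e, |y e| ≤ 1 / 2) ∧ ∀ e ∈ S, y e = ((σ e : ℤ) : ℝ) / 2}

/-- Projection does not change pairings with flows, and `|a| ≤ a * a` for integers. -/
theorem cubeFace_subset_voronoiCell (o : G.RefOrientation) (S : Set E(G)) (σ : E(G) → ℤˣ) :
    o.cubeFace S σ ⊆ o.voronoiCell := by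
  rintro _ ⟨y, ⟨hy, -⟩, rfl⟩
  refine (o.mem_voronoiCell_iff _).2 fun a ha => ?_
  have h := Submodule.inner_orthogonalProjectionOnto_eq_of_mem_right
    (K := o.flowSpace) ⟨toEuclidean a, o.toEuclidean_mem_flowSpace ha⟩ y
  rw [Submodule.coe_inner] at h
  rw [h, EuclideanSpace.real_inner_eq_sum, EuclideanSpace.real_inner_eq_sum, Finset.sum_div]
  refine Finset.sum_le_sum fun e _ => ?_
  simp only [toEuclidean_apply]
  have h1 : |(a e : ℝ)| ≤ (a e : ℝ) * a e := by
    rw [← abs_mul_abs_self]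
    rcases eq_or_ne (a e) 0 with h | h
    · simp [h]
    · have : (1 : ℝ) ≤ |(a e : ℝ)| := by exact_mod_cast Int.one_le_abs h
      nlinarith
  calc y e * a e ≤ |y e| * |(a e : ℝ)| := by rw [← abs_mul]; exact le_abs_self _
    _ ≤ 1 / 2 * |(a e : ℝ)| := by gcongr; exact hy e
    _ ≤ _ := by linarith

theorem cubeFace_nonempty (o : G.RefOrientation) (S : Set E(G)) (σ : E(G) → ℤˣ) :
    (o.cubeFace S σ).Nonempty := by
  refine ⟨_, WithLp.toLp 2 fun e => ((σ e : ℤ) : ℝ) / 2, ⟨fun e => ?_, fun e _ => rfl⟩, rfl⟩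
  rcases Int.units_coe_real_eq_one_or (σ e) with h | h <;> simp [h, abs_div]

/-- The Voronoi cell of the flow lattice is the projection of the unit cube. -/
theorem exists_cube_of_mem_voronoiCell (o : G.RefOrientation) {x : o.flowSpace}
    (hx : x ∈ o.voronoiCell) : ∃ y : EuclideanSpace ℝ E(G), (∀ e, |y e| ≤ 1 / 2) ∧
      o.flowSpace.orthogonalProjectionOnto y = x := by
  classical
  have hcube : {y : EuclideanSpace ℝ E(G) | ∀ e, |y e| ≤ 1 / 2} =
      (EuclideanSpace.equiv E(G) ℝ).symm '' Set.univ.pi fun _ => Set.Icc (-(1 / 2)) (1 / 2) := by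
    ext y
    simp only [Set.mem_ofPred_eq, abs_le]
    constructor
    · exact fun h => ⟨EuclideanSpace.equiv E(G) ℝ y, fun e _ => h e, by simp⟩
    · rintro ⟨z, hz, rfl⟩ e
      exact hz e trivial
  have hcompact : IsCompact {y : EuclideanSpace ℝ E(G) | ∀ e, |y e| ≤ 1 / 2} := by
    rw [hcube]
    exact (isCompact_univ_pi fun _ => isCompact_Icc).image (ContinuousLinearEquiv.continuous _)
  have hconvex : Convex ℝ {y : EuclideanSpace ℝ E(G) | ∀ e, |y e| ≤ 1 / 2} := by
    rw [hcube]
    exact (convex_pi fun _ _ => convex_Icc _ _).linear_image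
      (EuclideanSpace.equiv E(G) ℝ).symm.toLinearEquiv.toLinearMap
  by_contra! hcon
  obtain ⟨l, u, hl, hu⟩ := geometric_hahn_banach_closed_point
    (hconvex.linear_image o.flowSpace.orthogonalProjectionOnto.toLinearMap)
    ((hcompact.image o.flowSpace.orthogonalProjectionOnto.continuous).isClosed) (x := x)
    (by rintro ⟨y, hy, hyx⟩; exact hcon y hy hyx)
  set f := (InnerProductSpace.toDual ℝ o.flowSpace).symm l
  have hlf : ∀ z, l z = inner ℝ f z := fun z => InnerProductSpace.toDual_symm_apply.symm
  -- The cube vertex with the signs of `f` already attains the bound of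
  -- `inner_le_of_mem_voronoiCell`, so `f` cannot separate `x` from the projected cube.
  let y : EuclideanSpace ℝ E(G) := WithLp.toLp 2 fun e => ((flowDirection f.1 e : ℤ) : ℝ) / 2
  have h1 := hl _ ⟨y, fun e => by
    rcases Int.units_coe_real_eq_one_or (flowDirection f.1 e) with h | h <;>
      simp [y, h, abs_div], rfl⟩
  have h2 : l (o.flowSpace.orthogonalProjectionOnto y) = (∑ e, |f.1 e|) / 2 := by
    rw [hlf, Submodule.inner_orthogonalProjectionOnto_eq_of_mem_left,
      EuclideanSpace.real_inner_eq_sum, Finset.sum_div]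
    refine Finset.sum_congr rfl fun e _ => ?_
    rw [← flowDirection_mul]
    simp only [y]
    ring
  have h3 := o.inner_le_of_mem_voronoiCell hx f.2
  rw [hlf, real_inner_comm, Submodule.coe_inner] at hu
  have h1' : l (o.flowSpace.orthogonalProjectionOnto y) < u := h1
  linarith

/-- The face of the Voronoi cell exposed by a flow. -/
theorem setOf_isMax_inner_eq_cubeFace (o : G.RefOrientation) {f : o.flowSpace} {S : Set E(G)}
    {σ : E(G) → ℤˣ} (hpos : ∀ e ∈ S, 0 < ((σ e : ℤ) : ℝ) * f.1 e) (hzero : ∀ e ∉ S, f.1 e = 0) :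
    {x | x ∈ o.voronoiCell ∧ ∀ z ∈ o.voronoiCell, inner ℝ f z ≤ inner ℝ f x} =
      o.cubeFace S σ := by
  have hmax : ∀ {x}, x ∈ o.cubeFace S σ → inner ℝ f x = (∑ e, |f.1 e|) / 2 := by
    rintro _ ⟨y, ⟨-, hy⟩, rfl⟩
    rw [Submodule.inner_orthogonalProjectionOnto_eq_of_mem_left,
      EuclideanSpace.real_inner_eq_sum, Finset.sum_div]
    refine Finset.sum_congr rfl fun e _ => ?_
    by_cases he : e ∈ S
    · have h := hpos e he
      rw [hy e he]
      rcases Int.units_coe_real_eq_one_or (σ e) with hs | hs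
      · rw [hs, one_mul] at h
        rw [hs, abs_of_pos h]; ring
      · rw [hs, neg_one_mul, neg_pos] at h
        rw [hs, abs_of_neg h]; ring
    · simp [hzero e he]
  have hle : ∀ z ∈ o.voronoiCell, inner ℝ f z ≤ (∑ e, |f.1 e|) / 2 := fun z hz => by
    rw [real_inner_comm, Submodule.coe_inner]
    exact o.inner_le_of_mem_voronoiCell hz f.2
  refine Set.Subset.antisymm ?_ fun x hx =>
    ⟨o.cubeFace_subset_voronoiCell S σ hx, fun z hz => (hmax hx).symm ▸ hle z hz⟩
  rintro x ⟨hx, hxmax⟩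
  obtain ⟨x₀, hx₀⟩ := o.cubeFace_nonempty S σ
  have hxv : (∑ e, |f.1 e|) / 2 ≤ inner ℝ f x :=
    hmax hx₀ ▸ hxmax x₀ (o.cubeFace_subset_voronoiCell S σ hx₀)
  obtain ⟨y, hy, rfl⟩ := o.exists_cube_of_mem_voronoiCell hx
  refine ⟨y, ⟨hy, ?_⟩, rfl⟩
  rw [Submodule.inner_orthogonalProjectionOnto_eq_of_mem_left,
      EuclideanSpace.real_inner_eq_sum, Finset.sum_div] at hxv
  have hterm : ∀ e ∈ Finset.univ, f.1 e * y e ≤ |f.1 e| / 2 := fun e _ => by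
    calc f.1 e * y e ≤ |f.1 e| * |y e| := by rw [← abs_mul]; exact le_abs_self _
      _ ≤ |f.1 e| * (1 / 2) := by gcongr; exact hy e
      _ = _ := by ring
  -- Equality of the sums forces equality in each coordinate.
  have heq := (Finset.sum_eq_sum_iff_of_le hterm).1 (le_antisymm (Finset.sum_le_sum hterm) hxv)
  intro e he
  have h1 := heq e (Finset.mem_univ e)
  have h := hpos e he
  rcases Int.units_coe_real_eq_one_or (σ e) with hs | hs
  · rw [hs, one_mul] at h
    rw [abs_of_pos h] at h1
    rw [hs]
    exact mul_left_cancel₀ h.ne' (by linarith)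
  · rw [hs, neg_one_mul, neg_pos] at h
    rw [abs_of_neg h] at h1
    rw [hs]
    exact mul_left_cancel₀ h.ne (by linarith)

theorem mem_orthogonal_vectorSpan_cubeFace (o : G.RefOrientation) (S : Set E(G))
    (σ : E(G) → ℤˣ) (g : o.flowSpace) :
    g ∈ (vectorSpan ℝ (o.cubeFace S σ))ᗮ ↔ ∀ e ∉ S, g.1 e = 0 := by
  classical
  rw [vectorSpan_def, Submodule.mem_orthogonal']
  constructor
  · intro h e he
    -- Moving only the free coordinate `e` stays in the cube face; pairing the displacement with `g`
    -- isolates `g e`.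
    let y : ℝ → EuclideanSpace ℝ E(G) := fun c =>
      WithLp.toLp 2 fun e' => if e' ∈ S then ((σ e' : ℤ) : ℝ) / 2 else if e' = e then c else 0
    have hy : ∀ c, |c| ≤ 1 / 2 → o.flowSpace.orthogonalProjectionOnto (y c) ∈ o.cubeFace S σ := by
      intro c hc
      refine ⟨y c, ⟨fun e' => ?_, fun e' he' => by simp [y, he']⟩, rfl⟩
      simp only [y]
      split_ifs
      · rcases Int.units_coe_real_eq_one_or (σ e') with h | h <;> simp [h, abs_div]
      · exact hc
      · simp
    have := h _ (Submodule.subset_span (Set.vsub_mem_vsub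
      (hy (1 / 2) (by norm_num [abs_of_pos])) (hy 0 (by simp))))
    rw [vsub_eq_sub, ← map_sub, Submodule.inner_orthogonalProjectionOnto_eq_of_mem_left,
      EuclideanSpace.real_inner_eq_sum, Finset.sum_eq_single e] at this
    · simpa [y, he] using this
    · intro e' _ he'
      simp [y, he']
    · simp
  · intro hg u hu
    induction hu using Submodule.span_induction with
    | zero => simp
    | add u v _ _ hu hv => rw [inner_add_right, hu, hv, add_zero]
    | smul c u _ hu => rw [inner_smul_right, hu, mul_zero]
    | mem u hu =>
      obtain ⟨_, ⟨y, ⟨-, hy⟩, rfl⟩, _, ⟨y', ⟨-, hy'⟩, rfl⟩, rfl⟩ := hu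
      dsimp only
      rw [vsub_eq_sub, ← map_sub, Submodule.inner_orthogonalProjectionOnto_eq_of_mem_left,
        EuclideanSpace.real_inner_eq_sum]
      refine Finset.sum_eq_zero fun e _ => ?_
      by_cases he : e ∈ S
      · simp [hy e he, hy' e he]
      · simp [hg e he]

theorem vectorSpan_cubeFace_congr (o : G.RefOrientation) (S : Set E(G)) (σ σ' : E(G) → ℤˣ) :
    vectorSpan ℝ (o.cubeFace S σ) = vectorSpan ℝ (o.cubeFace S σ') := by
  rw [← Submodule.orthogonal_orthogonal (vectorSpan ℝ (o.cubeFace S σ)),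
    ← Submodule.orthogonal_orthogonal (vectorSpan ℝ (o.cubeFace S σ'))]
  congr 1
  ext g
  simp only [mem_orthogonal_vectorSpan_cubeFace]

end Graph.RefOrientation

/-! ### Strong orientations, positive flows and their faces. -/

namespace Graph.RefOrientation

variable {α β : Type*} {G H : Graph α β}

theorem isLink_tail_head (o : G.RefOrientation) (s : ℤˣ) (e : E(G)) :
    G.IsLink e (o.tail s e) (o.head s e) := by
  unfold RefOrientation.tail RefOrientation.head
  split_ifs
  · exact o.isLink e
  · exact (o.isLink e).symm

theorem dirAdj_eq_arc (o : G.RefOrientation) (hH : H ≤s G) (ω : SubOrientation H)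
    {σ : E(G) → ℤˣ} (hσ : ∀ (e : E(G)) (h : (e : β) ∈ E(H)), σ e = ω ⟨e, h⟩) :
    o.DirAdj hH ω = o.Arc {e | (e : β) ∈ E(H)} σ := by
  ext x y
  constructor
  · rintro ⟨e, ht, hh⟩
    refine ⟨⟨e, hH.le.edgeSet_mono e.2⟩, e.2, ?_⟩
    rw [hσ _ e.2]
    exact ⟨ht, hh⟩
  · rintro ⟨e, he, ht, hh⟩
    rw [hσ e he] at ht hh
    exact ⟨⟨e, he⟩, ht, hh⟩

theorem OrientedCircuit.follows_iff {o : G.RefOrientation} (C : o.OrientedCircuit)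
    (ω : SubOrientation H) {σ : E(G) → ℤˣ}
    (hσ : ∀ (e : E(G)) (h : (e : β) ∈ E(H)), σ e = ω ⟨e, h⟩) :
    C.Follows ω ↔ ∀ i, C.edge i ∈ {e : E(G) | (e : β) ∈ E(H)} ∧ σ (C.edge i) = C.sign i := by
  refine forall_congr' fun i => ?_
  constructor
  · rintro ⟨h, h'⟩
    exact ⟨h, (hσ _ h).trans h'⟩
  · rintro ⟨h, h'⟩
    exact ⟨h, (hσ _ h).symm.trans h'⟩

theorem IsStrong.exists_follows {o : G.RefOrientation} {hH : H ≤s G} {ω : SubOrientation H}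
    (hω : o.IsStrong hH ω) {e : E(G)} (he : (e : β) ∈ E(H)) :
    ∃ C : o.OrientedCircuit, C.Follows ω ∧ ∃ i, C.edge i = e := by
  classical
  let σ : E(G) → ℤˣ := fun e => if h : (e : β) ∈ E(H) then ω ⟨e, h⟩ else 1
  have hσ : ∀ (e : E(G)) (h : (e : β) ∈ E(H)), σ e = ω ⟨e, h⟩ := fun e h => dif_pos h
  have hl : H.IsLink e (o.head (σ e) e) (o.tail (σ e) e) :=
    (hH.le.isLink_iff he).2 (o.isLink_tail_head _ e).symm
  have hpath := hω _ hl.left_mem _ hl.right_mem (.single ⟨e, hl⟩)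
  rw [o.dirAdj_eq_arc hH ω hσ] at hpath
  obtain ⟨C, hC, i, hi⟩ := o.exists_orientedCircuit he hpath
  exact ⟨C, (C.follows_iff ω hσ).2 hC, i, hi⟩

variable [Fintype E(G)]

/-- An orientation carrying a positive flow is strong. -/
theorem isStrong_of_pos_flow (o : G.RefOrientation) (hH : H ≤s G) (ω : SubOrientation H)
    {σ : E(G) → ℤˣ} (hσ : ∀ (e : E(G)) (h : (e : β) ∈ E(H)), σ e = ω ⟨e, h⟩)
    {f : EuclideanSpace ℝ E(G)} (hf : f ∈ o.flowSpace)
    (hpos : ∀ e : E(G), (e : β) ∈ E(H) → 0 < ((σ e : ℤ) : ℝ) * f e)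
    (hzero : ∀ e : E(G), (e : β) ∉ E(H) → f e = 0) : o.IsStrong hH ω := by
  rintro u - v - huv
  rw [o.dirAdj_eq_arc hH ω hσ]
  induction huv with
  | refl => exact .refl
  | @tail a b _ hab ih =>
    refine ih.trans ?_
    obtain ⟨e, he⟩ := hab
    have heG := hH.le.edgeSet_mono he.edge_mem
    -- The edge is walked either along its arc or against it; in the latter case the positive flow
    -- supplies a directed detour.
    rcases (o.isLink_tail_head (σ ⟨e, heG⟩) ⟨e, heG⟩).eq_and_eq_or_eq_and_eq (he.mono hH.le)
      with ⟨h1, h2⟩ | ⟨h1, h2⟩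
    · exact .single ⟨⟨e, heG⟩, he.edge_mem, h1, h2⟩
    · exact o.reflTransGen_arc_symm hf hpos hzero ⟨⟨e, heG⟩, he.edge_mem, h1, h2⟩

/-- A strong orientation carries a positive flow, and its face is the projection of the
corresponding face of the cube. -/
theorem IsStrong.exists_pos_flow_and_voronoiFace_eq {o : G.RefOrientation} {hH : H ≤s G}
    {ω : SubOrientation H} (hω : o.IsStrong hH ω) {σ : E(G) → ℤˣ}
    (hσ : ∀ (e : E(G)) (h : (e : β) ∈ E(H)), σ e = ω ⟨e, h⟩) :
    ∃ f : o.flowSpace, (∀ e : E(G), (e : β) ∈ E(H) → 0 < ((σ e : ℤ) : ℝ) * f.1 e) ∧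
      (∀ e : E(G), (e : β) ∉ E(H) → f.1 e = 0) ∧
      o.voronoiFace ω = {x | x ∈ o.voronoiCell ∧
        ∀ z ∈ o.voronoiCell, inner ℝ f z ≤ inner ℝ f x} ∧
      o.voronoiFace ω = o.cubeFace {e | (e : β) ∈ E(H)} σ := by
  classical
  have hex : ∀ e : {e : E(G) // (e : β) ∈ E(H)}, ∃ C : o.OrientedCircuit,
      C.Follows ω ∧ ∃ i, C.edge i = e := fun e => hω.exists_follows e.2
  choose C hC hCe using hex
  let c : {e : E(G) // (e : β) ∈ E(H)} → o.flowSpace := fun e =>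
    ⟨toEuclidean (C e).elem, o.toEuclidean_mem_flowSpace (C e).elem_mem_intFlows⟩
  -- One directed circuit through each edge of `H`; all agree in sign with `ω`, so nothing cancels.
  let f : o.flowSpace := ∑ e, c e
  have hfe : ∀ e, f.1 e = ∑ e', ((C e').elem e : ℝ) := fun e => by
    simp [f, c]
  have helem : ∀ e' e, ((C e').elem e : ℝ) = 0 ∨
      ((e : β) ∈ E(H) ∧ ((C e').elem e : ℝ) = ((σ e : ℤ) : ℝ)) := fun e' e => by
    rcases (C e').elem_eq (((C e').follows_iff ω hσ).1 (hC e')) e with h | ⟨h, h'⟩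
    · exact Or.inl (by exact_mod_cast h)
    · exact Or.inr ⟨h, by exact_mod_cast h'⟩
  have hpos : ∀ e : E(G), (e : β) ∈ E(H) → 0 < ((σ e : ℤ) : ℝ) * f.1 e := by
    intro e he
    rw [hfe, Finset.mul_sum]
    refine Finset.sum_pos' (fun e' _ => ?_) ⟨⟨e, he⟩, Finset.mem_univ _, ?_⟩
    · rcases helem e' e with h | ⟨-, h⟩ <;> simp only [h]
      · simp
      · exact mul_self_nonneg _
    · obtain ⟨i, hi⟩ := hCe ⟨e, he⟩
      have h := (((C ⟨e, he⟩).follows_iff ω hσ).1 (hC ⟨e, he⟩) i).2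
      have h' := (C ⟨e, he⟩).elem_edge i
      rw [← h, hi] at h'
      simp only at h'
      rw [h']
      rcases Int.units_coe_real_eq_one_or (σ e) with hs | hs <;> simp [hs]
  have hzero : ∀ e : E(G), (e : β) ∉ E(H) → f.1 e = 0 := by
    intro e he
    rw [hfe]
    exact Finset.sum_eq_zero fun e' _ => (helem e' e).resolve_right fun h => he h.1
  have hface := o.setOf_isMax_inner_eq_cubeFace (S := {e | (e : β) ∈ E(H)}) hpos hzero
  -- Tightness for each summand circuit makes `x` maximize every summand, hence `f`.
  have hsub₁ : o.voronoiFace ω ⊆ {x | x ∈ o.voronoiCell ∧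
      ∀ z ∈ o.voronoiCell, inner ℝ f z ≤ inner ℝ f x} := by
    rintro x ⟨hx, hxC⟩
    refine ⟨hx, fun z hz => ?_⟩
    simp only [f, sum_inner]
    refine Finset.sum_le_sum fun e _ => ?_
    rw [real_inner_comm z, real_inner_comm x, Submodule.coe_inner, Submodule.coe_inner]
    exact ((o.mem_voronoiCell_iff z).1 hz _ (C e).elem_mem_intFlows).trans_eq
      (hxC _ (hC e)).2.symm
  have hsub₂ : o.cubeFace {e | (e : β) ∈ E(H)} σ ⊆ o.voronoiFace ω := by
    intro x hx
    have hxV := o.cubeFace_subset_voronoiCell _ _ hx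
    refine ⟨hxV, fun D hD => ⟨hxV, ?_⟩⟩
    obtain ⟨y, ⟨-, hy⟩, rfl⟩ := hx
    have h := Submodule.inner_orthogonalProjectionOnto_eq_of_mem_right
      (K := o.flowSpace) ⟨toEuclidean D.elem, o.toEuclidean_mem_flowSpace D.elem_mem_intFlows⟩ y
    rw [Submodule.coe_inner] at h
    rw [h, EuclideanSpace.real_inner_eq_sum, EuclideanSpace.real_inner_eq_sum, Finset.sum_div]
    refine Finset.sum_congr rfl fun e _ => ?_
    simp only [toEuclidean_apply]
    rcases D.elem_eq ((D.follows_iff ω hσ).1 hD) e with h | ⟨he, h⟩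
    · simp [h]
    · rw [hy e he, h]
      ring
  exact ⟨f, hpos, hzero, hsub₁.antisymm (hface.trans_subset hsub₂),
    (hsub₁.trans_eq hface).antisymm hsub₂⟩

end Graph.RefOrientation

/-! ### Comparison of parallel faces. -/

theorem mainTheorem4 {α β : Type*} (G : Graph α β) [Finite V(G)] [Fintype E(G)]
    (o : G.RefOrientation) (H : Graph α β) (hH : H ≤s G)
    (ω : Graph.SubOrientation H) (hω : o.IsStrong hH ω) :
    {F : Set o.flowSpace | ∃ ω' : Graph.SubOrientation H,
        o.IsStrong hH ω' ∧ F = o.voronoiFace ω'} =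
      {F : Set o.flowSpace | o.IsVoronoiFace F ∧
        (affineSpan ℝ F).Parallel (affineSpan ℝ (o.voronoiFace ω)) ∧
        o.codim F = o.codim (o.voronoiFace ω)} := by
  classical
  -- The value `1` off `E(H)` is arbitrary: `cubeFace` reads signs only on `E(H)`.
  let ext : Graph.SubOrientation H → E(G) → ℤˣ := fun ω e =>
    if h : (e : β) ∈ E(H) then ω ⟨e, h⟩ else 1
  have hext : ∀ (ω : Graph.SubOrientation H) (e : E(G)) (h : (e : β) ∈ E(H)),
      ext ω e = ω ⟨e, h⟩ := fun ω e h => dif_pos h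
  obtain ⟨f, hfpos, hfzero, -, hfcube⟩ := hω.exists_pos_flow_and_voronoiFace_eq (hext ω)
  ext F
  constructor
  · rintro ⟨ω', hω', rfl⟩
    obtain ⟨f', -, -, hexp, hcube⟩ := hω'.exists_pos_flow_and_voronoiFace_eq (hext ω')
    have hspan : vectorSpan ℝ (o.voronoiFace ω') = vectorSpan ℝ (o.voronoiFace ω) := by
      rw [hcube, hfcube, o.vectorSpan_cubeFace_congr]
    have hne := o.cubeFace_nonempty {e | (e : β) ∈ E(H)}
    refine ⟨⟨hcube ▸ hne _, fun _ => ⟨InnerProductSpace.toDual ℝ o.flowSpace f', hexp⟩⟩, ?_, ?_⟩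
    · rw [AffineSubspace.affineSpan_parallel_iff_vectorSpan_eq_and_eq_empty_iff_eq_empty]
      refine ⟨hspan, iff_of_false ?_ ?_⟩
      · exact (hcube ▸ hne _ : (o.voronoiFace ω').Nonempty).ne_empty
      · exact (hfcube ▸ hne _ : (o.voronoiFace ω).Nonempty).ne_empty
    · rw [Graph.RefOrientation.codim, Graph.RefOrientation.codim, hspan]
  · rintro ⟨⟨hne, hexp⟩, hpar, -⟩
    obtain ⟨l, hl⟩ := hexp hne
    let g := (InnerProductSpace.toDual ℝ o.flowSpace).symm l
    have hlg : ∀ z, l z = inner ℝ g z := fun z => InnerProductSpace.toDual_symm_apply.symm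
    have hgpos : ∀ e ∈ {e | g.1 e ≠ 0}, 0 < ((Graph.flowDirection g.1 e : ℤ) : ℝ) * g.1 e :=
      fun e he => by rw [Graph.flowDirection_mul]; exact abs_pos.2 he
    have hgzero : ∀ e ∉ {e | g.1 e ≠ 0}, g.1 e = 0 := fun e he => by simpa using he
    have hF : F = o.cubeFace {e | g.1 e ≠ 0} (Graph.flowDirection g.1) := by
      rw [hl, ← o.setOf_isMax_inner_eq_cubeFace hgpos hgzero]
      simp only [hlg]
    have horth := congrArg Submodule.orthogonal hpar.vectorSpan_eq
    rw [hF, hfcube] at horth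
    have hiff : ∀ h : o.flowSpace, (∀ e ∉ {e | g.1 e ≠ 0}, h.1 e = 0) ↔
        ∀ e ∉ {e : E(G) | (e : β) ∈ E(H)}, h.1 e = 0 := fun h => by
      rw [← o.mem_orthogonal_vectorSpan_cubeFace _ (Graph.flowDirection g.1), horth,
        o.mem_orthogonal_vectorSpan_cubeFace]
    -- Testing `hiff` on `g` gives one inclusion, on the positive flow `f` of `ω` the other.
    have hS : {e | g.1 e ≠ 0} = {e : E(G) | (e : β) ∈ E(H)} := by
      ext e
      constructor
      · intro he
        by_contra hcon
        exact he ((hiff g).1 hgzero e hcon)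
      · intro he
        by_contra hcon
        have := hfpos e he
        rw [(hiff f).2 hfzero e hcon, mul_zero] at this
        exact this.false
    rw [hS] at hF hgpos hgzero
    let ω' : Graph.SubOrientation H := fun e =>
      Graph.flowDirection g.1 ⟨e, hH.le.edgeSet_mono e.2⟩
    have hω'σ : ∀ (e : E(G)) (h : (e : β) ∈ E(H)), Graph.flowDirection g.1 e = ω' ⟨e, h⟩ :=
      fun _ _ => rfl
    have hω' : o.IsStrong hH ω' := o.isStrong_of_pos_flow hH ω' hω'σ g.2 hgpos hgzero
    obtain ⟨_, -, -, -, hcube⟩ := hω'.exists_pos_flow_and_voronoiFace_eq hω'σ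
    exact ⟨ω', hω', hF.trans hcube.symm⟩
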